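/- A complete edge-colored graph $G$ is a complete graph on a non-empty finite vertex set $V$ together with a color for each edge; $G$ (and likewise a graph derived from $G$) is $k$-edge-colored if exactly $k$ colors occur on its edges. A labeling of a graph on a finite vertex set $V$ is a bijection $\ell\colon V\to\{1,\dots,|V|\}$. A graph $(V,E)$ together with $\ell$ is a simple permutation graph of a permutation $\pi$ of $\{1,\dots,|V|\}$ if for all $u,v\in V$ with $\ell(u)>\ell(v)$ one has $\{u,v\}\in E\iff \pi^{-1}(\ell(u))<\pi^{-1}(\ell(v))$; it is a simple permutation graph if this holds for some $\ell$ and $\pi$. The monochromatic subgraph $G_{|i}$ has vertex set $V$ and the edges of color $i$, where $i$ is a color that occurs in $G$. $G$ is a complete edge-colored permutation graph if there is one labeling $\ell$ of $G$ such that for every color $i$ the graph $G_{|i}$ together with $\ell$ is a simple permutation graph of some permutation $\pi_i$. A rainbow triangle consists of three vertices whose three edges have pairwise distinct colors. A module of $G$ is a set $M\subseteq V$ such that for each $v\in V\setminus M$ all edges between $v$ and $M$ have the same color. A strong module is a non-empty module $M$ such that every module $M'$ satisfies $M\subseteq M'$, $M'\subseteq M$ or $M\cap M'=\emptyset$. The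 modular decomposition of $G$ is the set of its strong modules. For a strong module $M$ with $|M|\ge 2$ let $\mathbb P_{\max}(M)$ be the set of the inclusion-maximal strong modules of $G$ properly contained in $M$, and let $\mathbb P_{\max}(\{v\})=\{\{v\}\}$. The quotient graph $G[M]/\mathbb P_{\max}(M)$ is the complete edge-colored graph with vertex set $\mathbb P_{\max}(M)$ in which $\{A,B\}$ has the color of the edges $\{u,v\}$ of $G$ with $u\in A$, $v\in B$ (they all have the same color). A strong module $M$ is series if its quotient graph has at least two vertices and is $1$-edge-colored, and prime otherwise. Theorem. For a complete edge-colored graph $G$ the following are equivalent: (i) $G$ is a complete edge-colored permutation graph; (ii) for every non-empty $W\subseteq V$ the induced subgraph $G[W]$ is a complete edge-colored permutation graph; (iii) for every strong module $M$ of $G$ the quotient graph $G[M]/\mathbb P_{\max}(M)$ is a complete edge-colored permutation graph; (iv) for every strong prime module $M$ of $G$ the quotient graph $G[M]/\mathbb P_{\max}(M)$ is a complete edge-colored permutation graph, and it is $2$-edge-colored whenever $|M|\ge 3$; (v) $G$ has no rainbow triangle, and each monochromatic subgraph $G_{|i}$ is, together with some labeling (which may depend on $i$), a simple permutation graph. Moreover,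 the second condition in (iv) follows from the first: if the quotient graph of every strong prime module of $G$ is a complete edge-colored permutation graph, then the quotient graph of every strong prime module $M$ with $|M|\ge 3$ is $2$-edge-colored. -/

import Mathlib

namespace ColoredPerm

open SimpleGraph

/-! A complete edge-colored graph on the vertex set `V` is a `TopEdgeLabeling V K`, a map from the
edges of the complete graph on `V` to `K`. Only the colors that occur on some edge count as colors
of the graph, so that an induced subgraph or a quotient graph, which may use fewer colors, is again
such an object. -/

section Permutation

/-- A labeling: a bijection from the vertices to `{0, …, |V| - 1}`. -/
abbrev Labeling (V : Type*) := V ≃ Fin (Nat.card V)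

/-- `(G, ℓ)` is the simple permutation graph of the permutation `π`: two vertices `u`, `v`, named
such that `ℓ u > ℓ v`, are adjacent if and only if `π⁻¹ (ℓ u) < π⁻¹ (ℓ v)`. -/
def IsPermGraphOf {V : Type*} (G : SimpleGraph V) (ℓ : Labeling V)
    (π : Equiv.Perm (Fin (Nat.card V))) : Prop :=
  ∀ u v : V, ℓ v < ℓ u → (G.Adj u v ↔ π⁻¹ (ℓ u) < π⁻¹ (ℓ v))

/-- `G` is a simple permutation graph. -/
def IsPermGraph {V : Type*} (G : SimpleGraph V) : Prop :=
  ∃ (ℓ : Labeling V) (π : Equiv.Perm (Fin (Nat.card V))), IsPermGraphOf G ℓ π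

/-- The set of colors that occur on the edges. -/
def colors {V K : Type*} (c : TopEdgeLabeling V K) : Set K :=
  {i | ∃ (u v : V) (h : u ≠ v), c.get u v h = i}

/-- The graph is `k`-edge-colored: exactly `k` colors occur. -/
def IsEdgeColored {V K : Type*} (c : TopEdgeLabeling V K) (k : ℕ) : Prop :=
  (colors c).encard = k

/-- `c` is a complete edge-colored permutation graph: for one common labeling `ℓ` and permutations
`π i`, one for each color, every monochromatic subgraph with `ℓ` is the simple permutation graph of
`π i`. -/
def IsColoredPermGraph {V K : Type*} (c : TopEdgeLabeling V K) : Prop :=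
  ∃ (ℓ : Labeling V) (π : colors c → Equiv.Perm (Fin (Nat.card V))),
    ∀ i : colors c, IsPermGraphOf (c.labelGraph i.1) ℓ (π i)

/-- There are three vertices whose edges have pairwise distinct colors. -/
def HasRainbowTriangle {V K : Type*} (c : TopEdgeLabeling V K) : Prop :=
  ∃ (u v w : V) (huv : u ≠ v) (huw : u ≠ w) (hvw : v ≠ w),
    c.get u v huv ≠ c.get u w huw ∧ c.get u v huv ≠ c.get v w hvw ∧
      c.get u w huw ≠ c.get v w hvw

/-- The subgraph induced by `W`, whose edges keep their colors. -/
abbrev induced {V K : Type*} (c : TopEdgeLabeling V K) (W : Set V) : TopEdgeLabeling W K :=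
  c.pullback (Function.Embedding.subtype (· ∈ W))

end Permutation

section Modules

/-- `M` is a module: every vertex outside `M` is joined to all of `M` in one color. -/
def IsModule {V K : Type*} (c : TopEdgeLabeling V K) (M : Set V) : Prop :=
  ∀ ⦃u w v : V⦄ (hu : u ∈ M) (hw : w ∈ M) (hv : v ∉ M),
    c.get u v (ne_of_mem_of_not_mem hu hv) = c.get w v (ne_of_mem_of_not_mem hw hv)

/-- `M` is a (non-empty) strong module: it overlaps no other module. The modular decomposition is
the set of all strong modules. -/
structure IsStrongModule {V K : Type*} (c : TopEdgeLabeling V K) (M : Set V) : Prop where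
  nonempty : M.Nonempty
  isModule : IsModule c M
  strong : ∀ M' : Set V, IsModule c M' → M ⊆ M' ∨ M' ⊆ M ∨ M ∩ M' = ∅

/-- `N` is a child of `M` in the inclusion tree of the strong modules. -/
def IsChild {V K : Type*} (c : TopEdgeLabeling V K) (M N : Set V) : Prop :=
  IsStrongModule c N ∧ N ⊂ M ∧ ¬ ∃ N' : Set V, IsStrongModule c N' ∧ N ⊂ N' ∧ N' ⊂ M

/-- The maximal modular partition of a strong module `M`: the set of its children if `M` has at
least two elements, and `{M}` if `M` is a singleton (which has no children). -/
def maxPartition {V K : Type*} (c : TopEdgeLabeling V K) (M : Set V) : Set (Set V) :=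
  {N | IsChild c M N ∨ (N = M ∧ IsStrongModule c M ∧ M.Subsingleton)}

theorem isStrongModule_of_mem {V K : Type*} {c : TopEdgeLabeling V K} {M N : Set V}
    (h : N ∈ maxPartition c M) : IsStrongModule c N := by
  rcases h with h | ⟨rfl, h, -⟩
  · exact h.1
  · exact h

/-- Distinct parts are disjoint. -/
theorem eq_of_mem_of_mem {V K : Type*} {c : TopEdgeLabeling V K} {M A B : Set V}
    (hA : A ∈ maxPartition c M) (hB : B ∈ maxPartition c M) {x : V} (hxA : x ∈ A) (hxB : x ∈ B) :
    A = B := by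
  have sA := isStrongModule_of_mem hA
  have sB := isStrongModule_of_mem hB
  have sub_singleton : ∀ {N : Set V}, N ⊂ M → N.Nonempty → M.Subsingleton → False := by
    intro N hN hne hM
    obtain ⟨y, hy⟩ := hne
    exact hN.2 fun z hz => hM hz (hN.1 hy) ▸ hy
  rcases hA with hA | ⟨rfl, -, hs⟩ <;> rcases hB with hB | ⟨rfl, -, hs'⟩
  · rcases sA.strong B sB.isModule with h | h | h
    · by_contra hne
      exact hA.2.2 ⟨B, sB, h.ssubset_of_ne hne, hB.2.1⟩
    · by_contra hne
      exact hB.2.2 ⟨A, sA, h.ssubset_of_ne (Ne.symm hne), hA.2.1⟩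
    · have : x ∈ A ∩ B := ⟨hxA, hxB⟩
      simp [h] at this
  · exact (sub_singleton hA.2.1 sA.nonempty hs').elim
  · exact (sub_singleton hB.2.1 sB.nonempty hs).elim
  · rfl

/-- A choice of one vertex from each part of the maximal modular partition. -/
noncomputable def representative {V K : Type*} (c : TopEdgeLabeling V K) (M : Set V) :
    maxPartition c M ↪ V where
  toFun A := (isStrongModule_of_mem A.2).nonempty.choose
  inj' A B h := by
    have hA := (isStrongModule_of_mem A.2).nonempty.choose_spec
    have hB := (isStrongModule_of_mem B.2).nonempty.choose_spec
    simp only at h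
    rw [← h] at hB
    exact Subtype.ext (eq_of_mem_of_mem A.2 B.2 hA hB)

/-- The quotient graph `G[M] / Pmax(M)`: its vertices are the parts of the maximal modular partition
of `M`, and the edge between two parts `A` and `B` has the color of an edge of `G` between a vertex
of `A` and a vertex of `B`. By `quotient_get` all these edges have the same color. -/
noncomputable def quotient {V K : Type*} (c : TopEdgeLabeling V K) (M : Set V) :
    TopEdgeLabeling (maxPartition c M) K :=
  c.pullback (representative c M)

theorem get_congr_of_isModule {V K : Type*} {c : TopEdgeLabeling V K} {A B : Set V}
    (hA : IsModule c A) (hB : IsModule c B) (hAB : Disjoint A B) {u u' v v' : V}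
    (hu : u ∈ A) (hu' : u' ∈ A) (hv : v ∈ B) (hv' : v' ∈ B) :
    c.get u v (hAB.ne_of_mem hu hv) = c.get u' v' (hAB.ne_of_mem hu' hv') := by
  have hvA : v ∉ A := fun h => hAB.ne_of_mem h hv rfl
  have huB : u' ∉ B := fun h => hAB.ne_of_mem hu' h rfl
  have e := hB hv hv' huB
  rw [EdgeLabeling.get_comm, EdgeLabeling.get_comm u' v'] at e
  exact (hA hu hu' hvA).trans e

theorem quotient_get {V K : Type*} (c : TopEdgeLabeling V K) (M : Set V)
    (A B : maxPartition c M) (hAB : A ≠ B) {u v : V} (hu : u ∈ A.1) (hv : v ∈ B.1)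
    (huv : u ≠ v) : (quotient c M).get A B hAB = c.get u v huv := by
  have hd : Disjoint A.1 B.1 := Set.disjoint_left.2 fun x hxA hxB =>
    hAB (Subtype.ext (eq_of_mem_of_mem A.2 B.2 hxA hxB))
  exact get_congr_of_isModule (isStrongModule_of_mem A.2).isModule
    (isStrongModule_of_mem B.2).isModule hd
    (isStrongModule_of_mem A.2).nonempty.choose_spec hu
    (isStrongModule_of_mem B.2).nonempty.choose_spec hv

/-- The quotient graph of `M` has at least two vertices and only one color. -/
def IsSeries {V K : Type*} (c : TopEdgeLabeling V K) (M : Set V) : Prop :=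
  (maxPartition c M).Nontrivial ∧ IsEdgeColored (quotient c M) 1

/-- `M` is a strong prime module: a strong module that is not series. -/
def IsStrongPrimeModule {V K : Type*} (c : TopEdgeLabeling V K) (M : Set V) : Prop :=
  IsStrongModule c M ∧ ¬ IsSeries c M

end Modules

end ColoredPerm

/-! Fix a linear order of the vertices, given by the labeling. A graph is the permutation graph of
some permutation for this order exactly if, for all u < v < w, the pair uw behaves like uv or like
vw (`exists_isPermGraphOf_iff`). Imposing this for all colors at once means that the color of uw is
the color of uv or of vw; this is `PermOn`, and `isColoredPermGraph_iff` is the translation. In this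
form the property clearly passes to induced subgraphs and to quotients (a quotient is induced on
representatives), and it excludes rainbow triangles. Orders can also be glued along modules: replace
each class by its own order inside an order of the classes (`permOn_of_fibers`).

Gluing along the tree of strong modules recovers an order of V from orders of the quotients; a
series quotient has one color, so any order suits it. For (v), Gallai's theorem
(`not_three_connected`) says that without rainbow triangles at most two colors are connected. So a
set with three colors has a nontrivial module, and induction glues; with at most two colors, an
order suited to one color suits the other, its complement.

A prime quotient has at most two colors for the same reason: a third color would give a nontrivial
module of the quotient. A maximal proper module above its lift is not strong, so another module
overlaps it, and this forces all edges across a cut to have one color. Then the quotient has a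
single color (`color_quotient_eq_of_cut`). -/

namespace ColoredPerm

open SimpleGraph

/-! ### Symmetric functions on pairs of vertices -/

section Abstract

variable {V α : Type*}

/-- On `S`, some linear order has the property that the color of the outer pair of any three
elements is the color of one of the two inner pairs. The order is given by an injection to `ℕ`. -/
def PermOn (d : V → V → α) (S : Set V) : Prop :=
  ∃ f : V → ℕ, Set.InjOn f S ∧ ∀ u ∈ S, ∀ v ∈ S, ∀ w ∈ S, f u < f v → f v < f w →
    d u w = d u v ∨ d u w = d v w

/-- There is no triple whose pairs have three distinct colors. -/
def RainbowFree (d : V → V → α) : Prop :=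
  ∀ u v w, d u v = d u w ∨ d u v = d v w ∨ d u w = d v w

/-- `N` is a module of the restriction of `d` to `S`. -/
def IsModuleOn (d : V → V → α) (S N : Set V) : Prop :=
  N ⊆ S ∧ ∀ u ∈ N, ∀ w ∈ N, ∀ v ∈ S, v ∉ N → d u v = d w v

/-- At most two colors occur on `S`. -/
def AtMostTwoOn (d : V → V → α) (S : Set V) : Prop :=
  ∃ i j, ∀ x ∈ S, ∀ y ∈ S, x ≠ y → d x y = i ∨ d x y = j

/-- Reachability within `S` along pairs that satisfy `P`. -/
abbrev ReachOn (P : V → V → Prop) (S : Set V) : V → V → Prop :=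
  Relation.ReflTransGen fun x y => x ∈ S ∧ y ∈ S ∧ P x y

theorem PermOn.mono {d : V → V → α} {S T : Set V} (h : PermOn d T) (hST : S ⊆ T) : PermOn d S := by
  obtain ⟨f, hf, h⟩ := h
  exact ⟨f, hf.mono hST, fun u hu v hv w hw => h u (hST hu) v (hST hv) w (hST hw)⟩

theorem permOn_of_subsingleton (d : V → V → α) {S : Set V} (h : S.Subsingleton) : PermOn d S :=
  ⟨fun _ => 0, h.injOn _, fun _ _ _ _ _ _ h => absurd h (lt_irrefl _)⟩

theorem exists_injective_nat (V : Type*) [Finite V] : ∃ f : V → ℕ, Function.Injective f := by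
  obtain ⟨n, ⟨e⟩⟩ := Finite.exists_equiv_fin V
  exact ⟨fun x => (e x : ℕ), fun x y h => e.injective (Fin.ext h)⟩

theorem permOn_of_const [Finite V] {d : V → V → α} {S : Set V} (i : α)
    (h : ∀ x ∈ S, ∀ y ∈ S, x ≠ y → d x y = i) : PermOn d S := by
  obtain ⟨f, hf⟩ := exists_injective_nat V
  refine ⟨f, hf.injOn, fun u hu v hv w hw huv hvw => Or.inl ?_⟩
  rw [h u hu w hw, h u hu v hv]
  · rintro rfl; exact lt_irrefl _ huv
  · rintro rfl; exact lt_asymm huv hvw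

theorem PermOn.rainbowFree {d : V → V → α} (hd : ∀ x y, d x y = d y x)
    (h : PermOn d Set.univ) : RainbowFree d := by
  obtain ⟨f, hf, h⟩ := h
  intro u v w
  have hi : ∀ x y, f x = f y → x = y := fun x y => hf.eq_iff (Set.mem_univ x) (Set.mem_univ y) |>.1
  have h' : ∀ x y z, f x < f y → f y < f z → d x z = d x y ∨ d x z = d y z :=
    fun x y z => h x trivial y trivial z trivial
  have huv := hd u v
  have huw := hd u w
  have hvw := hd v w
  rcases lt_trichotomy (f u) (f v) with h1 | h1 | h1 <;>
  rcases lt_trichotomy (f u) (f w) with h2 | h2 | h2 <;>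
  rcases lt_trichotomy (f v) (f w) with h3 | h3 | h3 <;>
  first
  | (exfalso; omega)
  | (cases hi _ _ h1; grind)
  | (cases hi _ _ h2; grind)
  | (cases hi _ _ h3; grind)
  | grind

/-- The lexicographic combination of orders of the classes of `p` with an order of the set of
classes. -/
theorem permOn_of_fibers [Finite V] {d : V → V → α} {S : Set V} (p : V → V)
    (hp : ∀ x ∈ S, ∀ y ∈ S, p x ≠ p y → d x y = d (p x) (p y))
    (himg : PermOn d (p '' S)) (hfib : ∀ y ∈ p '' S, PermOn d {x ∈ S | p x = y}) :
    PermOn d S := by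
  obtain ⟨g, hg, hg'⟩ := himg
  have hex : ∀ y, ∃ f : V → ℕ, y ∈ p '' S → Set.InjOn f {x ∈ S | p x = y} ∧
      ∀ u ∈ {x ∈ S | p x = y}, ∀ v ∈ {x ∈ S | p x = y}, ∀ w ∈ {x ∈ S | p x = y},
      f u < f v → f v < f w → d u w = d u v ∨ d u w = d v w := by
    intro y
    by_cases hy : y ∈ p '' S
    · obtain ⟨f, hf⟩ := hfib y hy
      exact ⟨f, fun _ => hf⟩
    · exact ⟨fun _ => 0, fun h => absurd h hy⟩
  choose h hh using hex
  -- With `N` above all values of `h`, the key `N * g + h` compares lexicographically.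
  obtain ⟨N, hN⟩ : ∃ N, ∀ x, h (p x) x < N := by
    obtain ⟨N, hN⟩ := (Set.finite_range fun x => h (p x) x).bddAbove
    exact ⟨N + 1, fun x => Nat.lt_succ_of_le (hN ⟨x, rfl⟩)⟩
  have hlt : ∀ x y, N * g (p x) + h (p x) x < N * g (p y) + h (p y) y →
      g (p x) < g (p y) ∨ g (p x) = g (p y) ∧ h (p x) x < h (p y) y := by
    intro x y hxy
    rcases lt_trichotomy (g (p x)) (g (p y)) with h1 | h1 | h1
    · exact Or.inl h1
    · rw [h1] at hxy
      exact Or.inr ⟨h1, by omega⟩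
    · exfalso
      have h2 := Nat.mul_le_mul_left N (Nat.succ_le_of_lt h1)
      rw [Nat.mul_succ] at h2
      have := hN y
      omega
  have hge : ∀ x y, N * g (p x) + h (p x) x = N * g (p y) + h (p y) y → g (p x) = g (p y) := by
    intro x y hxy
    have hx := hN x
    have hy := hN y
    rcases lt_trichotomy (g (p x)) (g (p y)) with h1 | h1 | h1
    · have h2 := Nat.mul_le_mul_left N (Nat.succ_le_of_lt h1)
      rw [Nat.mul_succ] at h2
      omega
    · exact h1
    · have h2 := Nat.mul_le_mul_left N (Nat.succ_le_of_lt h1)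
      rw [Nat.mul_succ] at h2
      omega
  have hm : ∀ x ∈ S, p x ∈ p '' S := fun x hx => Set.mem_image_of_mem p hx
  refine ⟨fun x => N * g (p x) + h (p x) x, ?_, ?_⟩
  · intro x hx y hy hxy
    have hpe : p x = p y := hg (hm x hx) (hm y hy) (hge x y hxy)
    refine (hh (p y) (hm y hy)).1 ⟨hx, hpe⟩ ⟨hy, rfl⟩ ?_
    simp only [hpe] at hxy
    omega
  · intro u hu v hv w hw huv hvw
    have h1 := hlt u v huv
    have h2 := hlt v w hvw
    have gi : ∀ x ∈ S, ∀ y ∈ S, g (p x) = g (p y) → p x = p y :=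
      fun x hx y hy hxy => hg (hm x hx) (hm y hy) hxy
    rcases h1 with h1 | ⟨h1, h1'⟩
    · have n1 : p u ≠ p v := fun h => by rw [h] at h1; omega
      have n3 : p u ≠ p w := fun h => by rw [h] at h1; omega
      rcases h2 with h2 | ⟨h2, h2'⟩
      · have n2 : p v ≠ p w := fun h => by rw [h] at h2; omega
        rw [hp u hu v hv n1, hp v hv w hw n2, hp u hu w hw n3]
        exact hg' _ (hm u hu) _ (hm v hv) _ (hm w hw) h1 h2
      · left
        rw [hp u hu v hv n1, hp u hu w hw n3, gi v hv w hw h2]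
    · have e1 := gi u hu v hv h1
      rcases h2 with h2 | ⟨h2, h2'⟩
      · have n2 : p v ≠ p w := fun h => by rw [h] at h2; omega
        right
        rw [hp v hv w hw n2, hp u hu w hw (e1 ▸ n2), e1]
      · have e2 := gi v hv w hw h2
        rw [e1] at h1'
        rw [← e2] at h2'
        exact (hh (p v) (hm v hv)).2 u ⟨hu, e1⟩ v ⟨hv, rfl⟩ w ⟨hw, e2.symm⟩ h1' h2'

/-! ### Monochromatic components and Gallai's theorem -/

theorem exists_step_of_reflTransGen {r : V → V → Prop} {x y : V} (h : Relation.ReflTransGen r x y)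
    {T : Set V} (hx : x ∈ T) (hy : y ∉ T) : ∃ a ∈ T, ∃ b, b ∉ T ∧ r a b := by
  induction h with
  | refl => exact absurd hx hy
  | @tail b c _ hbc ih =>
    by_cases hb : b ∈ T
    · exact ⟨b, hb, c, hy, hbc⟩
    · exact ih hb

theorem ReachOn.symm {P : V → V → Prop} (hP : ∀ x y, P x y → P y x) {S : Set V} {x y : V}
    (h : ReachOn P S x y) : ReachOn P S y x := by
  induction h with
  | refl => exact Relation.ReflTransGen.refl
  | tail _ h ih => exact ih.head ⟨h.2.1, h.1, hP _ _ h.2.2⟩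

theorem ReachOn.mem {P : V → V → Prop} {S : Set V} {x y : V} (hx : x ∈ S)
    (h : ReachOn P S x y) : y ∈ S := by
  induction h with
  | refl => exact hx
  | tail _ h _ => exact h.2.1

/-- If there is no rainbow triangle, the components of each monochromatic subgraph are modules. -/
theorem get_eq_of_reachOn {d : V → V → α} (hr : RainbowFree d)
    {S : Set V} {i : α} {a a' b : V} (hbS : b ∈ S)
    (h : ReachOn (fun x y => d x y = i) S a a') (hb : ¬ ReachOn (fun x y => d x y = i) S a b) :
    d a b = d a' b := by
  induction h with
  | refl => rfl
  | @tail x y hx hxy ih =>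
    have h1 : d x b ≠ i := fun e => hb (hx.tail ⟨hxy.1, hbS, e⟩)
    have h2 : d y b ≠ i := fun e => hb ((hx.tail hxy).tail ⟨hxy.2.1, hbS, e⟩)
    have h3 := hr x y b
    have h4 := hxy.2.2
    rw [ih]
    grind

theorem exists_get_eq_of_connected {d : V → V → α} {S : Set V} {i : α}
    (h : ∀ x ∈ S, ∀ y ∈ S, ReachOn (fun x y => d x y = i) S x y) {v x : V} (hv : v ∈ S)
    (hx : x ∈ S) (hvx : x ≠ v) : ∃ y ∈ S, y ≠ v ∧ d v y = i := by
  obtain ⟨a, ha, b, hb, hab⟩ := exists_step_of_reflTransGen (h v hv x hx) (T := {v}) rfl hvx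
  cases ha
  exact ⟨b, hab.2.1, hb, hab.2.2⟩

/-- Deleting a vertex `v` from a set without rainbow triangles on which three colors are connected
leaves each of them connected. -/
theorem connected_diff_singleton {d : V → V → α} (hd : ∀ x y, d x y = d y x) (hr : RainbowFree d)
    {S : Set V} {i j k : α} (hij : i ≠ j) (hik : i ≠ k) (hjk : j ≠ k) {v : V} (hv : v ∈ S)
    (hS : ∃ x ∈ S, x ≠ v)
    (hi : ∀ x ∈ S, ∀ y ∈ S, ReachOn (fun x y => d x y = i) S x y)
    (hj : ∀ x ∈ S, ∀ y ∈ S, ReachOn (fun x y => d x y = j) S x y)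
    (hk : ∀ x ∈ S, ∀ y ∈ S, ReachOn (fun x y => d x y = k) S x y) :
    ∀ x ∈ S \ {v}, ∀ y ∈ S \ {v}, ReachOn (fun x y => d x y = i) (S \ {v}) x y := by
  by_contra hcon
  set R := ReachOn (fun x y => d x y = i) (S \ {v}) with hR
  have hsymm : ∀ {x y}, R x y → R y x := fun h => ReachOn.symm (fun x y h => (hd y x).trans h) h
  have htrans : ∀ {x y z}, R x y → R y z → R x z := fun h1 h2 => h1.trans h2
  obtain ⟨x, hx, hxv⟩ := hS
  obtain ⟨b, hbS, hbv, hb⟩ := exists_get_eq_of_connected hj hv hx hxv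
  obtain ⟨b', hbS', hbv', hb'⟩ := exists_get_eq_of_connected hk hv hx hxv
  -- Color `i` connects `S`, so every `i`-component left after deleting `v` contains an `i`-neighbor
  -- of `v`.
  have hcomp : ∀ z ∈ S \ {v}, ∃ a ∈ S \ {v}, R z a ∧ d v a = i := by
    intro z hz
    obtain ⟨a, ha, y, hy, hay⟩ := exists_step_of_reflTransGen (hi z hz.1 v hv)
      (T := {y | R z y}) Relation.ReflTransGen.refl (fun h => (ReachOn.mem hz h).2 rfl)
    have haS := ReachOn.mem hz ha
    have hyv : y = v := by
      by_contra hyv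
      exact hy (Relation.ReflTransGen.tail ha ⟨haS, ⟨hay.2.1, hyv⟩, hay.2.2⟩)
    subst hyv
    exact ⟨a, haS, ha, (hd _ _).trans hay.2.2⟩
  have hbT : b ∈ S \ {v} := ⟨hbS, hbv⟩
  have hbT' : b' ∈ S \ {v} := ⟨hbS', hbv'⟩
  have hne : ∀ a ∈ S \ {v}, ∀ z ∈ S \ {v}, ¬ R a z → d a z ≠ i :=
    fun a ha z hz h e => h (Relation.ReflTransGen.single ⟨ha, hz, e⟩)
  -- If `b`, `b'` share a component, an `i`-neighbor `a` of `v` in another one sees both in the same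
  -- color; but the triangles `v a b` and `v a b'` force the colors `j` and `k`. Otherwise the
  -- `i`-neighbors of `v` in the two components force both `j` and `k` on the edge `b b'`.
  by_cases hbb : R b b'
  · obtain ⟨y, hy, hby⟩ : ∃ y ∈ S \ {v}, ¬ R b y := by
      by_contra hall
      push Not at hall
      exact hcon fun x hx y hy => htrans (hsymm (hall x hx)) (hall y hy)
    obtain ⟨a, haT, hya, hva⟩ := hcomp y hy
    have hba : ¬ R b a := fun h => hby (htrans h (hsymm hya))
    have hba' : ¬ R b' a := fun h => hba (htrans hbb h)
    have e := get_eq_of_reachOn hr haT hbb hba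
    have n1 := hne b hbT a haT hba
    have n2 := hne b' hbT' a haT hba'
    have r1 := hr v a b
    have r2 := hr v a b'
    rw [hd a] at r1 r2
    grind
  · obtain ⟨a, haT, hba, hva⟩ := hcomp b hbT
    obtain ⟨a', haT', hba', hva'⟩ := hcomp b' hbT'
    have h1 : ¬ R b' b := fun h => hbb (hsymm h)
    have h2 : ¬ R a b' := fun h => hbb (htrans hba h)
    have h3 : ¬ R a' b := fun h => h1 (htrans hba' h)
    have e1 := get_eq_of_reachOn hr hbT' hba hbb
    have e2 := get_eq_of_reachOn hr hbT hba' h1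
    have n1 := hne a haT b' hbT' h2
    have n2 := hne a' haT' b hbT h3
    have r1 := hr v a b'
    have r2 := hr v a' b
    have e3 := hd b b'
    grind

/-- Gallai: in a coloring without rainbow triangles, at most two colors span a connected graph. -/
theorem not_three_connected {d : V → V → α} (hd : ∀ x y, d x y = d y x) (hr : RainbowFree d)
    {i j k : α} (hij : i ≠ j) (hik : i ≠ k) (hjk : j ≠ k) {S : Set V} (hfin : S.Finite)
    (hS : S.Nontrivial)
    (hi : ∀ x ∈ S, ∀ y ∈ S, ReachOn (fun x y => d x y = i) S x y)
    (hj : ∀ x ∈ S, ∀ y ∈ S, ReachOn (fun x y => d x y = j) S x y)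
    (hk : ∀ x ∈ S, ∀ y ∈ S, ReachOn (fun x y => d x y = k) S x y) : False := by
  induction S, hfin using Set.Finite.induction_on with
  | empty => simp at hS
  | @insert v T hvT _ ih =>
    have hST : insert v T \ {v} = T := by simp [hvT]
    have hex : ∃ x ∈ insert v T, x ≠ v := hS.exists_ne v
    have hv : v ∈ insert v T := Set.mem_insert v T
    by_cases hT : T.Nontrivial
    · have ci := connected_diff_singleton hd hr hij hik hjk hv hex hi hj hk
      have cj := connected_diff_singleton hd hr hij.symm hjk hik hv hex hj hi hk
      have ck := connected_diff_singleton hd hr hik.symm hjk.symm hij hv hex hk hi hj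
      rw [hST] at ci cj ck
      exact ih hT ci cj ck
    -- Only two vertices remain, and their single edge would have both colors `i` and `j`.
    · rw [Set.not_nontrivial_iff] at hT
      obtain ⟨x, hx, hxv⟩ := hex
      obtain ⟨y, hy, hyv, ei⟩ := exists_get_eq_of_connected hi hv hx hxv
      obtain ⟨z, hz, hzv, ej⟩ := exists_get_eq_of_connected hj hv hx hxv
      have : y = z := hT (hy.resolve_left hyv) (hz.resolve_left hzv)
      subst this
      exact hij (ei.symm.trans ej)

/-- A coloring without rainbow triangles in which at least three colors occur has a nontrivial
module. -/
theorem exists_module_of_not_atMostTwoOn {d : V → V → α} (hd : ∀ x y, d x y = d y x)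
    (hr : RainbowFree d) {S : Set V} (hfin : S.Finite) (h2 : ¬ AtMostTwoOn d S)
    (hS : S.Nontrivial) : ∃ N, IsModuleOn d S N ∧ N.Nontrivial ∧ N ≠ S := by
  -- The component containing an edge of a disconnected color is the required module.
  have key : ∀ i, (∃ x ∈ S, ∃ y ∈ S, x ≠ y ∧ d x y = i) →
      (¬ ∀ x ∈ S, ∀ y ∈ S, ReachOn (fun x y => d x y = i) S x y) →
      ∃ N, IsModuleOn d S N ∧ N.Nontrivial ∧ N ≠ S := by
    rintro i ⟨x, hx, y, hy, hxy, e⟩ hc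
    have hsymm : ∀ {x y}, ReachOn (fun x y => d x y = i) S x y →
        ReachOn (fun x y => d x y = i) S y x :=
      fun h => ReachOn.symm (fun x y h => (hd y x).trans h) h
    refine ⟨{z | ReachOn (fun x y => d x y = i) S x z}, ⟨fun z hz => ReachOn.mem hx hz, ?_⟩,
      ⟨x, Relation.ReflTransGen.refl, y, Relation.ReflTransGen.single ⟨hx, hy, e⟩, hxy⟩, ?_⟩
    · intro u hu w hw v hv hvx
      exact (get_eq_of_reachOn hr hv hu hvx).symm.trans
        (get_eq_of_reachOn hr hv hw hvx)
    · intro he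
      refine hc fun a ha b hb => ?_
      rw [← he] at ha hb
      exact (hsymm ha).trans hb
  obtain ⟨x, hx, y, hy, hxy⟩ := hS
  have h2' : ∀ i j, ∃ a ∈ S, ∃ b ∈ S, a ≠ b ∧ d a b ≠ i ∧ d a b ≠ j := by
    intro i j
    by_contra hcon
    refine h2 ⟨i, j, fun a ha b hb hab => ?_⟩
    by_contra hn
    push Not at hn
    exact hcon ⟨a, ha, b, hb, hab, hn⟩
  obtain ⟨a, ha, b, hb, hab, n1, -⟩ := h2' (d x y) (d x y)
  obtain ⟨a', ha', b', hb', hab', n2, n3⟩ := h2' (d x y) (d a b)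
  by_contra hcon
  have hc : ∀ i, (∃ x ∈ S, ∃ y ∈ S, x ≠ y ∧ d x y = i) →
      ∀ x ∈ S, ∀ y ∈ S, ReachOn (fun x y => d x y = i) S x y :=
    fun i hi => by_contra fun h => hcon (key i hi h)
  exact not_three_connected hd hr n1.symm n2.symm n3.symm hfin ⟨x, hx, y, hy, hxy⟩
    (hc _ ⟨x, hx, y, hy, hxy, rfl⟩) (hc _ ⟨a, ha, b, hb, hab, rfl⟩)
    (hc _ ⟨a', ha', b', hb', hab', rfl⟩)

/-- Without rainbow triangles, it suffices to find an order for each color separately. -/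
theorem permOn_of_rainbowFree [Finite V] {d : V → V → α} (hd : ∀ x y, d x y = d y x)
    (hr : RainbowFree d)
    (hmono : ∀ i, (∃ x y, x ≠ y ∧ d x y = i) → PermOn (fun x y => d x y = i) Set.univ)
    (S : Set V) : PermOn d S := by
  induction hn : S.ncard using Nat.strong_induction_on generalizing S with
  | _ n ih =>
  subst hn
  by_cases hS : S.Nontrivial
  swap
  · exact permOn_of_subsingleton d (Set.not_nontrivial_iff.1 hS)
  have hlt : ∀ T, T ⊂ S → PermOn d T :=
    fun T hT => ih _ (Set.ncard_lt_ncard hT S.toFinite) T rfl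
  by_cases h2 : AtMostTwoOn d S
  · obtain ⟨i, j, hij⟩ := h2
    -- The hypothesis `hmono` covers only colors that occur, so the case without `i` is separate.
    by_cases hc : ∀ x ∈ S, ∀ y ∈ S, x ≠ y → d x y = j
    · exact permOn_of_const j hc
    · push Not at hc
      obtain ⟨x, hx, y, hy, hxy, hne⟩ := hc
      obtain ⟨f, hf, h⟩ := hmono i ⟨x, y, hxy, (hij x hx y hy hxy).resolve_right hne⟩
      refine ⟨f, hf.mono (Set.subset_univ S), fun u hu v hv w hw huv hvw => ?_⟩
      have h1 := h u trivial v trivial w trivial huv hvw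
      simp only [eq_iff_iff] at h1
      have n1 : u ≠ v := by rintro rfl; omega
      have n2 : v ≠ w := by rintro rfl; omega
      have n3 : u ≠ w := by rintro rfl; omega
      have e1 := hij u hu v hv n1
      have e2 := hij v hv w hw n2
      have e3 := hij u hu w hw n3
      grind
  · obtain ⟨N, ⟨hNS, hN⟩, hNn, hne⟩ := exists_module_of_not_atMostTwoOn hd hr S.toFinite h2 hS
    classical
    obtain ⟨m, hm, m', hm', hmm⟩ := hNn
    have hN' : N ⊂ S := hNS.ssubset_of_ne hne
    -- Contract `N` to `m`: the image misses `m'`, and each fiber is `N` or a single vertex, so all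
    -- are smaller than `S`.
    refine permOn_of_fibers (fun x => if x ∈ N then m else x) ?_ (hlt _ ?_) ?_
    · intro x hx y hy hxy
      by_cases h1 : x ∈ N <;> by_cases h2 : y ∈ N <;> simp only [h1, h2, if_true, if_false] at hxy ⊢
      · exact absurd rfl hxy
      · exact hN x h1 m hm y hy h2
      · rw [hd x, hd x]
        exact hN y h2 m hm x hx h1
    · refine (Set.ssubset_iff_of_subset ?_).2 ⟨m', hNS hm', ?_⟩
      · rintro _ ⟨x, hx, rfl⟩
        dsimp only
        split_ifs
        exacts [hNS hm, hx]
      · rintro ⟨x, hx, h⟩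
        dsimp only at h
        split_ifs at h with h1
        · exact hmm h
        · exact h1 (h ▸ hm')
    · rintro _ ⟨y, hy, rfl⟩
      refine hlt _ ?_
      by_cases h1 : y ∈ N
      · refine lt_of_le_of_lt (fun x hx => ?_) hN'
        obtain ⟨hx1, hx2⟩ := hx
        by_contra h3
        simp only [h1, h3, if_true, if_false] at hx2
        exact h3 (hx2 ▸ hm)
      · refine (Set.ssubset_iff_of_subset fun x hx => hx.1).2 ⟨m, hNS hm, fun h => h1 ?_⟩
        have := h.2
        simp only [hm, h1, if_true, if_false] at this
        exact this ▸ hm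

end Abstract

/-! ### Permutation graphs in terms of a linear order -/

section Order

/-- The rank function of a strict linear order on a finite type. -/
theorem exists_labeling_of_order {V : Type*} [Finite V] (r : V → V → Prop) (hirr : ∀ a, ¬ r a a)
    (htrans : ∀ a b c, r a b → r b c → r a c) (htot : ∀ a b, a ≠ b → r a b ∨ r b a) :
    ∃ e : Labeling V, ∀ a b, r a b ↔ e a < e b := by
  have hmono : ∀ a b, r a b → {x | r x a}.ncard < {x | r x b}.ncard := fun a b hab =>
    Set.ncard_lt_ncard ((Set.ssubset_iff_of_subset fun x hx => htrans x a b hx hab).2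
      ⟨a, hab, hirr a⟩) (Set.toFinite _)
  have hlt : ∀ a, {x | r x a}.ncard < Nat.card V := fun a => by
    rw [← Set.ncard_univ]
    exact Set.ncard_lt_ncard ((Set.ssubset_iff_of_subset (Set.subset_univ _)).2
      ⟨a, trivial, hirr a⟩) (Set.toFinite _)
  have hinj : Function.Injective fun a => (⟨_, hlt a⟩ : Fin (Nat.card V)) := by
    intro a b hab
    have hab' := Fin.mk.inj hab
    by_contra hne
    rcases htot a b hne with h | h
    · exact (hmono _ _ h).ne hab'
    · exact (hmono _ _ h).ne' hab'
  have hbij := (Nat.bijective_iff_injective_and_card _).2 ⟨hinj, (Nat.card_fin _).symm⟩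
  refine ⟨Equiv.ofBijective _ hbij, fun a b => ⟨fun h => hmono a b h, fun h => ?_⟩⟩
  have h' : {x | r x a}.ncard < {x | r x b}.ncard := h
  by_contra hn
  rcases eq_or_ne a b with rfl | hne
  · exact lt_irrefl _ h'
  · exact lt_asymm h' (hmono b a ((htot a b hne).resolve_left hn))

theorem exists_labeling_of_injective {V : Type*} [Finite V] {f : V → ℕ}
    (hf : Function.Injective f) : ∃ e : Labeling V, ∀ a b, f a < f b ↔ e a < e b :=
  exists_labeling_of_order (fun a b => f a < f b) (fun _ => lt_irrefl _)
    (fun _ _ _ => lt_trans) fun _ _ h => lt_or_gt_of_ne (hf.ne h)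

/-- The composite of `l` with `π⁻¹` is a second linear order, which reverses `l` on edges and keeps
it on non-edges. The condition on triples says that the relation so defined is transitive. -/
theorem exists_isPermGraphOf_iff {V : Type*} [Finite V] (G : SimpleGraph V) (l : Labeling V) :
    (∃ π, IsPermGraphOf G l π) ↔ ∀ u v w, l u < l v → l v < l w →
      (G.Adj u w ↔ G.Adj u v) ∨ (G.Adj u w ↔ G.Adj v w) := by
  constructor
  · rintro ⟨π, h⟩ u v w huv hvw
    have h1 := h v u huv
    have h2 := h w v hvw
    have h3 := h w u (huv.trans hvw)
    rw [G.adj_comm] at h1 h2 h3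
    rw [h1, h2, h3]
    omega
  · intro h
    have hne : ∀ {a b}, a ≠ b → l a < l b ∨ l b < l a := fun hab =>
      lt_or_gt_of_ne (l.injective.ne hab)
    obtain ⟨e, he⟩ := exists_labeling_of_order
      (fun a b => (l a < l b ∧ ¬ G.Adj a b) ∨ (l b < l a ∧ G.Adj b a))
      (fun a => by simp) (fun a b c hab hbc => by
        have s1 := G.adj_comm a b
        have s2 := G.adj_comm b c
        have s3 := G.adj_comm a c
        have hac : a ≠ c := by
          rintro rfl
          have : ∀ {p q : Fin (Nat.card V)}, p < q → q < p → False := fun h h' => lt_asymm h h'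
          grind
        have h1 := h a b c
        have h2 := h a c b
        have h3 := h b a c
        have h4 := h b c a
        have h5 := h c a b
        have h6 := h c b a
        rcases hab with ⟨p1, q1⟩ | ⟨p1, q1⟩ <;> rcases hbc with ⟨p2, q2⟩ | ⟨p2, q2⟩ <;>
          rcases hne hac with p3 | p3 <;> simp only [p3, true_and]
        · grind
        · exact absurd (p1.trans p2) (lt_asymm p3)
        · grind
        · grind
        · grind
        · grind
        · exact absurd (p2.trans p1) (lt_asymm p3)
        · grind)
      (fun a b hab => by
        have := hne hab
        have := G.adj_comm a b
        grind)
    -- Chosen so that `π⁻¹ (l u) = e u`.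
    refine ⟨(l.symm.trans e)⁻¹, fun u v huv => ?_⟩
    simp only [inv_inv, Equiv.trans_apply, Equiv.symm_apply_apply]
    rw [← he]
    have := G.adj_comm u v
    have := lt_asymm huv
    grind

end Order

/-! ### Colorings as symmetric functions on pairs -/

section Color

variable {V K : Type*}

open Classical in
/-- The color of a pair, with the value `none` on the diagonal. -/
noncomputable def color (c : TopEdgeLabeling V K) (u v : V) : Option K :=
  if h : u ≠ v then some (c.get u v h) else none

theorem color_of_ne (c : TopEdgeLabeling V K) {u v : V} (h : u ≠ v) :
    color c u v = some (c.get u v h) := dif_pos h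

theorem color_self (c : TopEdgeLabeling V K) (u : V) : color c u u = none := by simp [color]

theorem color_comm (c : TopEdgeLabeling V K) (u v : V) : color c u v = color c v u := by
  rcases eq_or_ne u v with rfl | h
  · rfl
  · rw [color_of_ne c h, color_of_ne c h.symm, EdgeLabeling.get_comm]

theorem color_eq_some_iff (c : TopEdgeLabeling V K) {u v : V} {i : K} :
    color c u v = some i ↔ (c.labelGraph i).Adj u v := by
  rw [TopEdgeLabeling.labelGraph_adj]
  by_cases h : u = v
  · subst h
    simp [color_self]
  · simp [color_of_ne c h, h]

theorem color_pullback {W : Type*} (c : TopEdgeLabeling V K) (e : W ↪ V) (x y : W) :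
    color (c.pullback e) x y = color c (e x) (e y) := by
  rcases eq_or_ne x y with rfl | h
  · rw [color_self, color_self]
  · rw [color_of_ne _ h, color_of_ne _ (e.injective.ne h)]
    rfl

theorem isColoredPermGraph_iff [Finite V] (c : TopEdgeLabeling V K) :
    IsColoredPermGraph c ↔ PermOn (color c) Set.univ := by
  have hstep : IsColoredPermGraph c ↔ ∃ l : Labeling V, ∀ i ∈ colors c, ∀ u v w,
      l u < l v → l v < l w → ((c.labelGraph i).Adj u w ↔ (c.labelGraph i).Adj u v) ∨
        ((c.labelGraph i).Adj u w ↔ (c.labelGraph i).Adj v w) := by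
    refine exists_congr fun l => ?_
    constructor
    · rintro ⟨π, h⟩ i hi
      exact (exists_isPermGraphOf_iff _ l).1 ⟨_, h ⟨i, hi⟩⟩
    · intro h
      choose π hπ using fun i : colors c => (exists_isPermGraphOf_iff _ l).2 (h i.1 i.2)
      exact ⟨π, hπ⟩
  rw [hstep]
  constructor
  · rintro ⟨l, h⟩
    refine ⟨fun x => l x, fun x _ y _ hxy => l.injective (Fin.ext hxy), ?_⟩
    intro u _ v _ w _ huv hvw
    have n1 : u ≠ v := by rintro rfl; exact lt_irrefl _ huv
    have n2 : v ≠ w := by rintro rfl; exact lt_irrefl _ hvw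
    have n3 : u ≠ w := by rintro rfl; exact lt_asymm huv hvw
    -- The color of the outer pair `u`, `w` itself is the one to test.
    rcases h _ ⟨u, w, n3, rfl⟩ u v w huv hvw with h1 | h1 <;>
      rw [← color_eq_some_iff, ← color_eq_some_iff, ← color_of_ne c n3] at h1
    · exact Or.inl (h1.1 rfl).symm
    · exact Or.inr (h1.1 rfl).symm
  · rintro ⟨f, hf, h⟩
    obtain ⟨l, hl⟩ := exists_labeling_of_injective (Set.injOn_univ.1 hf)
    refine ⟨l, fun i _ u v w huv hvw => ?_⟩
    simp only [← color_eq_some_iff]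
    rw [← hl] at huv hvw
    rcases h u trivial v trivial w trivial huv hvw with e | e <;> simp [e]

theorem permOn_of_isPermGraph [Finite V] {c : TopEdgeLabeling V K} {i : K}
    (h : IsPermGraph (c.labelGraph i)) :
    PermOn (fun x y => color c x y = some i) Set.univ := by
  obtain ⟨l, h⟩ := h
  refine ⟨fun x => l x, fun x _ y _ hxy => l.injective (Fin.ext hxy), ?_⟩
  intro u _ v _ w _ huv hvw
  simp only [color_eq_some_iff, eq_iff_iff]
  exact (exists_isPermGraphOf_iff _ l).1 h u v w huv hvw

theorem PermOn.comp {W α : Type*} {d : V → V → α} (h : PermOn d Set.univ) (e : W ↪ V) :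
    PermOn (fun x y => d (e x) (e y)) Set.univ := by
  obtain ⟨f, hf, h⟩ := h
  exact ⟨fun x => f (e x), fun x _ y _ hxy => e.injective (hf trivial trivial hxy),
    fun u _ v _ w _ => h _ trivial _ trivial _ trivial⟩

theorem PermOn.range_of_comp {W α : Type*} {d : V → V → α} (e : W ↪ V)
    (h : PermOn (fun x y => d (e x) (e y)) Set.univ) : PermOn d (Set.range e) := by
  obtain ⟨f, hf, h⟩ := h
  refine ⟨Function.extend e f 0, ?_, ?_⟩
  · rintro _ ⟨x, rfl⟩ _ ⟨y, rfl⟩ hxy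
    rw [e.injective.extend_apply, e.injective.extend_apply] at hxy
    rw [hf trivial trivial hxy]
  · rintro _ ⟨u, rfl⟩ _ ⟨v, rfl⟩ _ ⟨w, rfl⟩ huv hvw
    rw [e.injective.extend_apply, e.injective.extend_apply] at huv hvw
    exact h u trivial v trivial w trivial huv hvw

theorem IsColoredPermGraph.pullback [Finite V] {W : Type*} {c : TopEdgeLabeling V K}
    (h : IsColoredPermGraph c) (e : W ↪ V) : IsColoredPermGraph (c.pullback e) := by
  have := Finite.of_injective e e.injective
  rw [isColoredPermGraph_iff] at h ⊢
  simpa only [← color_pullback] using h.comp e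

/-- Moves an order of a quotient to the representatives inside `V`, where `permOn_of_fibers` can use
it. -/
theorem permOn_range_of_pullback [Finite V] {W : Type*} {c : TopEdgeLabeling V K} (e : W ↪ V)
    (h : IsColoredPermGraph (c.pullback e)) : PermOn (color c) (Set.range e) := by
  have := Finite.of_injective e e.injective
  rw [isColoredPermGraph_iff] at h
  refine PermOn.range_of_comp e ?_
  simpa only [← color_pullback] using h

theorem rainbowFree_iff (c : TopEdgeLabeling V K) :
    RainbowFree (color c) ↔ ¬ HasRainbowTriangle c := by
  constructor
  · rintro h ⟨u, v, w, huv, huw, hvw, h1, h2, h3⟩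
    have := h u v w
    simp only [color_of_ne c huv, color_of_ne c huw, color_of_ne c hvw, Option.some.injEq] at this
    tauto
  · intro h u v w
    by_cases huv : u = v
    · subst huv; simp
    by_cases huw : u = w
    · subst huw; rw [color_comm c v u]; simp
    by_cases hvw : v = w
    · subst hvw; simp
    simp only [color_of_ne c huv, color_of_ne c huw, color_of_ne c hvw, Option.some.injEq]
    by_contra hn
    push Not at hn
    exact h ⟨u, v, w, huv, huw, hvw, hn⟩

end Color

/-! ### Strong modules -/

section StrongModules

variable {V K : Type*} {c : TopEdgeLabeling V K}

theorem isModule_iff {M : Set V} :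
    IsModule c M ↔ ∀ u ∈ M, ∀ w ∈ M, ∀ v, v ∉ M → color c u v = color c w v := by
  constructor
  · intro h u hu w hw v hv
    rw [color_of_ne c (ne_of_mem_of_not_mem hu hv), color_of_ne c (ne_of_mem_of_not_mem hw hv),
      h hu hw hv]
  · intro h u w v hu hw hv
    have := h u hu w hw v hv
    rwa [color_of_ne c (ne_of_mem_of_not_mem hu hv), color_of_ne c (ne_of_mem_of_not_mem hw hv),
      Option.some.injEq] at this

theorem IsModule.color_eq {M : Set V} (h : IsModule c M) {u w v : V} (hu : u ∈ M) (hw : w ∈ M)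
    (hv : v ∉ M) : color c u v = color c w v :=
  isModule_iff.1 h u hu w hw v hv

theorem IsModule.union {M N : Set V} (hM : IsModule c M) (hN : IsModule c N)
    (h : (M ∩ N).Nonempty) : IsModule c (M ∪ N) := by
  obtain ⟨x, hxM, hxN⟩ := h
  have key : ∀ u ∈ M ∪ N, ∀ v, v ∉ M ∪ N → color c u v = color c x v := by
    rintro u (hu | hu) v hv
    · exact hM.color_eq hu hxM fun h => hv (Or.inl h)
    · exact hN.color_eq hu hxN fun h => hv (Or.inr h)
  exact isModule_iff.2 fun u hu w hw v hv => (key u hu v hv).trans (key w hw v hv).symm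

theorem isStrongModule_singleton (c : TopEdgeLabeling V K) (x : V) : IsStrongModule c {x} where
  nonempty := Set.singleton_nonempty x
  isModule := isModule_iff.2 fun u hu w hw v _ => by rw [hu, hw]
  strong M' _ := by
    by_cases h : x ∈ M'
    · exact Or.inl (Set.singleton_subset_iff.2 h)
    · exact Or.inr (Or.inr (Set.singleton_inter_eq_empty.2 h))

theorem isStrongModule_univ [Nonempty V] (c : TopEdgeLabeling V K) :
    IsStrongModule c Set.univ where
  nonempty := Set.univ_nonempty
  isModule := isModule_iff.2 fun _ _ _ _ _ hv => absurd trivial hv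
  strong M' _ := Or.inr (Or.inl (Set.subset_univ M'))

theorem subset_of_mem_maxPartition {M A : Set V} (h : A ∈ maxPartition c M) : A ⊆ M := by
  rcases h with h | h
  · exact h.2.1.1
  · exact h.1.subset

/-- Enlarge the strong module `{x}` to a maximal one below `M`. Together with `eq_of_mem_of_mem`,
the children partition `M`. -/
theorem exists_isChild [Finite V] {M : Set V} (hM : M.Nontrivial) {x : V} (hx : x ∈ M) :
    ∃ A, IsChild c M A ∧ x ∈ A := by
  have hxM : {x} ⊂ M := by
    refine (Set.singleton_subset_iff.2 hx).ssubset_of_ne fun h => ?_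
    rw [← h] at hM
    exact Set.not_nontrivial_singleton hM
  obtain ⟨A, hxA, hA⟩ := Finite.exists_le_maximal
    (p := fun A : Set V => IsStrongModule c A ∧ A ⊂ M) ⟨isStrongModule_singleton c x, hxM⟩
  refine ⟨A, ⟨hA.prop.1, hA.prop.2, ?_⟩, hxA rfl⟩
  rintro ⟨N, hN, hAN, hNM⟩
  exact hAN.2 (hA.2 ⟨hN, hNM⟩ hAN.1)

theorem IsChild.subset_of_mem {M A N : Set V} (hA : IsChild c M A) (hN : IsStrongModule c N)
    (hNM : N ⊂ M) {x : V} (hxA : x ∈ A) (hxN : x ∈ N) : N ⊆ A := by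
  rcases hA.1.strong N hN.isModule with h | h | h
  · by_contra hn
    exact hA.2.2 ⟨N, hN, ⟨h, hn⟩, hNM⟩
  · exact h
  · exact absurd (show x ∈ A ∩ N from ⟨hxA, hxN⟩) (by simp [h])

theorem maxPartition_nontrivial [Finite V] {M : Set V} (hM : M.Nontrivial) :
    (maxPartition c M).Nontrivial := by
  obtain ⟨x, hx⟩ := hM.nonempty
  obtain ⟨A, hA, -⟩ := exists_isChild (c := c) hM hx
  obtain ⟨z, hz, hzA⟩ := Set.exists_of_ssubset hA.2.1
  obtain ⟨B, hB, hzB⟩ := exists_isChild (c := c) hM hz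
  exact ⟨A, Or.inl hA, B, Or.inl hB, fun h => hzA (h ▸ hzB)⟩

theorem color_quotient {M : Set V} {A B : maxPartition c M} (hAB : A ≠ B) {u v : V}
    (hu : u ∈ A.1) (hv : v ∈ B.1) : color (quotient c M) A B = color c u v := by
  have huv : u ≠ v := by
    rintro rfl
    exact hAB (Subtype.ext (eq_of_mem_of_mem A.2 B.2 hu hv))
  rw [color_of_ne _ hAB, color_of_ne _ huv, quotient_get c M A B hAB hu hv huv]

theorem representative_mem {M : Set V} (A : maxPartition c M) : representative c M A ∈ A.1 :=
  (isStrongModule_of_mem A.2).nonempty.choose_spec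

/-- The order of a strong module is composed from orders of its children and of its quotient. -/
theorem permOn_of_quotient [Finite V] {M : Set V} (hM : M.Nontrivial)
    (hq : IsColoredPermGraph (quotient c M))
    (hch : ∀ A, IsChild c M A → PermOn (color c) A) : PermOn (color c) M := by
  have hex : ∀ x, ∃ A : maxPartition c M, x ∈ M → IsChild c M A.1 ∧ x ∈ A.1 := by
    intro x
    by_cases hx : x ∈ M
    · obtain ⟨A, hA, hxA⟩ := exists_isChild (c := c) hM hx
      exact ⟨⟨A, Or.inl hA⟩, fun _ => ⟨hA, hxA⟩⟩
    · obtain ⟨A, hA⟩ := (maxPartition_nontrivial (c := c) hM).nonempty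
      exact ⟨⟨A, hA⟩, fun h => absurd h hx⟩
  choose A hA using hex
  refine permOn_of_fibers (fun x => representative c M (A x)) ?_ ?_ ?_
  · intro x hx y hy hxy
    have hne : A x ≠ A y := fun h => hxy (congrArg _ h)
    exact (color_quotient hne (hA x hx).2 (hA y hy).2).symm.trans
      (color_quotient hne (representative_mem _) (representative_mem _))
  · refine (permOn_range_of_pullback (representative c M) hq).mono ?_
    rintro _ ⟨x, -, rfl⟩
    exact ⟨A x, rfl⟩
  · rintro _ ⟨y, hy, rfl⟩
    refine (hch (A y).1 (hA y hy).1).mono ?_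
    rintro x ⟨hx, hxy⟩
    rw [← (representative c M).injective hxy]
    exact (hA x hx).2

theorem isColoredPermGraph_of_isEdgeColored_one [Finite V]
    (h : IsEdgeColored c 1) : IsColoredPermGraph c := by
  obtain ⟨i, hi⟩ := Set.encard_eq_one.1 h
  refine (isColoredPermGraph_iff c).2 (permOn_of_const (some i) fun x _ y _ hxy => ?_)
  have : c.get x y hxy ∈ colors c := ⟨x, y, hxy, rfl⟩
  rw [hi] at this
  rw [color_of_ne c hxy, this]

/-- Induction up the tree of strong modules; series quotients need no hypothesis, having one color.
-/
theorem permOn_of_strongPrimeModules [Finite V]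
    (h : ∀ M, IsStrongPrimeModule c M → IsColoredPermGraph (quotient c M)) {M : Set V}
    (hM : IsStrongModule c M) : PermOn (color c) M := by
  induction hn : M.ncard using Nat.strong_induction_on generalizing M with
  | _ n ih =>
  subst hn
  by_cases hM' : M.Nontrivial
  · refine permOn_of_quotient hM' ?_ fun A hA => ih _ (Set.ncard_lt_ncard hA.2.1 M.toFinite) hA.1 rfl
    by_cases hs : IsSeries c M
    · exact isColoredPermGraph_of_isEdgeColored_one hs.2
    · exact h M ⟨hM, hs⟩
  · exact permOn_of_subsingleton _ (Set.not_nontrivial_iff.1 hM')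

/-- The components of a strong module `M` with respect to the edges of colors other than `i` are
strong modules. -/
theorem isStrongModule_component {M : Set V} (hM : IsStrongModule c M) (i : Option K) {x : V}
    (hx : x ∈ M) :
    IsStrongModule c {z | ReachOn (fun x y => color c x y ≠ i) M x z} := by
  set C := {z | ReachOn (fun x y => color c x y ≠ i) M x z} with hC
  have hCM : C ⊆ M := fun z hz => ReachOn.mem hx hz
  have hout : ∀ u ∈ C, ∀ v ∈ M, v ∉ C → color c u v = i := by
    intro u hu v hv hvC
    by_contra hne
    exact hvC (Relation.ReflTransGen.tail hu ⟨hCM hu, hv, hne⟩)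
  have hsymm : ∀ x y, color c x y ≠ i → color c y x ≠ i := fun x y h => color_comm c x y ▸ h
  refine ⟨⟨x, Relation.ReflTransGen.refl⟩, isModule_iff.2 fun u hu w hw v hv => ?_, ?_⟩
  · by_cases hvM : v ∈ M
    · rw [hout u hu v hvM hv, hout w hw v hvM hv]
    · exact hM.isModule.color_eq (hCM hu) (hCM hw) hvM
  · intro M' hM'
    rcases hM.strong M' hM' with h | h | h
    · exact Or.inl (hCM.trans h)
    · by_contra hn
      push Not at hn
      obtain ⟨h1, h2, y, hyC, hyM⟩ := hn
      obtain ⟨t, htC, htM⟩ := Set.not_subset.1 h1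
      obtain ⟨z, hzM, hzC⟩ := Set.not_subset.1 h2
      -- A path in `C` from `y` to `t` leaves `M'` along an edge `a b` of color other than `i`. But
      -- `z` in `M'` outside `C` is joined to `b` in color `i`, and the module `M'` gives `a b` the
      -- same color.
      obtain ⟨a, ha, b, hb, hab⟩ := exists_step_of_reflTransGen
        ((ReachOn.symm hsymm hyC).trans htC) (T := {w | w ∈ C → w ∈ M'}) (fun _ => hyM)
        (fun h => htM (h htC))
      have hbC : b ∈ C := by_contra fun h => hb fun h' => absurd h' h
      have hbM : b ∉ M' := fun h => hb fun _ => h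
      have haC : a ∈ C := Relation.ReflTransGen.tail hbC ⟨hab.2.1, hab.1, hsymm _ _ hab.2.2⟩
      refine hab.2.2 ?_
      rw [hM'.color_eq (ha haC) hzM hbM, color_comm]
      exact hout b hbC z (h hzM) hzC
    · exact Or.inr (Or.inr (Set.subset_empty_iff.1 ((Set.inter_subset_inter_left _ hCM).trans h.le)))

/-- If all edges across a cut of a strong module `M` have color `i`, then `i` is the only color of
the quotient graph of `M`. -/
theorem color_quotient_eq_of_cut [Finite V] {M : Set V} (hM : IsStrongModule c M) (i : Option K)
    {T : Set V} (hT : (M ∩ T).Nonempty) (hT' : (M \ T).Nonempty)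
    (hcut : ∀ x ∈ M ∩ T, ∀ y ∈ M \ T, color c x y = i) {A B : maxPartition c M} (hAB : A ≠ B) :
    color (quotient c M) A B = i := by
  obtain ⟨x, hx⟩ := (isStrongModule_of_mem A.2).nonempty
  obtain ⟨y, hy⟩ := (isStrongModule_of_mem B.2).nonempty
  have hxM := subset_of_mem_maxPartition A.2 hx
  have hyM := subset_of_mem_maxPartition B.2 hy
  rw [color_quotient hAB hx hy]
  -- An edge `x y` of another color puts `x` and `y` in one non-`i` component. That strong module is
  -- proper because of the cut, so it lies in one child, and `A = B`.
  by_contra hne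
  have hxy : x ≠ y := by
    rintro rfl
    exact hAB (Subtype.ext (eq_of_mem_of_mem A.2 B.2 hx hy))
  obtain ⟨N, hN, hxN⟩ := exists_isChild (c := c) ⟨x, hxM, y, hyM, hxy⟩ hxM
  have hC := isStrongModule_component hM i hxM
  have hCM : {z | ReachOn (fun x y => color c x y ≠ i) M x z} ⊂ M := by
    refine Set.ssubset_iff_subset_ne.2 ⟨fun z hz => ReachOn.mem hxM hz, fun he => ?_⟩
    obtain ⟨a, haM, haT⟩ := hT
    obtain ⟨b, hbM, hbT⟩ := hT'
    have ha := haM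
    have hb := hbM
    rw [← he] at ha hb
    obtain ⟨a', ha', b', hb', h⟩ := exists_step_of_reflTransGen
      ((ReachOn.symm (fun x y h => color_comm c x y ▸ h) ha).trans hb) haT hbT
    exact h.2.2 (hcut a' ⟨h.1, ha'⟩ b' ⟨h.2.1, hb'⟩)
  have hyN : y ∈ N := hN.subset_of_mem hC hCM hxN Relation.ReflTransGen.refl
    (Relation.ReflTransGen.single ⟨hxM, hyM, hne⟩)
  exact hAB (Subtype.ext ((eq_of_mem_of_mem A.2 (Or.inl hN) hx hxN).trans
    (eq_of_mem_of_mem B.2 (Or.inl hN) hy hyN).symm))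

theorem isModule_of_isModuleOn_quotient [Finite V] {M : Set V} (hM : IsStrongModule c M)
    (hM' : M.Nontrivial) {N : Set (maxPartition c M)}
    (hN : IsModuleOn (color (quotient c M)) Set.univ N) :
    IsModule c {x | ∃ A ∈ N, x ∈ A.1} := by
  refine isModule_iff.2 ?_
  rintro u ⟨A, hA, hu⟩ w ⟨B, hB, hw⟩ v hv
  by_cases hvM : v ∈ M
  · obtain ⟨C, hC, hvC⟩ := exists_isChild (c := c) hM' hvM
    have hCN : (⟨C, Or.inl hC⟩ : maxPartition c M) ∉ N := fun h => hv ⟨_, h, hvC⟩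
    rw [← color_quotient (ne_of_mem_of_not_mem hA hCN) hu hvC,
      ← color_quotient (ne_of_mem_of_not_mem hB hCN) hw hvC]
    exact hN.2 A hA B hB _ trivial hCN
  · exact hM.isModule.color_eq (subset_of_mem_maxPartition A.2 hu)
      (subset_of_mem_maxPartition B.2 hw) hvM

/-- The quotient of a strong module has at most two colors if it has no rainbow triangle. -/
theorem atMostTwoOn_quotient [Finite V] {M : Set V} (hM : IsStrongModule c M)
    (hM' : M.Nontrivial) (hr : RainbowFree (color (quotient c M))) :
    AtMostTwoOn (color (quotient c M)) Set.univ := by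
  by_contra h2
  have hpart := maxPartition_nontrivial (c := c) hM'
  have : Nontrivial (maxPartition c M) := Set.nontrivial_coe_sort.2 hpart
  obtain ⟨N₀, hN₀, ⟨A, hA, B, hB, hAB⟩, hne⟩ :=
    exists_module_of_not_atMostTwoOn (color_comm _) hr Set.finite_univ h2 Set.nontrivial_univ
  set U := {x | ∃ A ∈ N₀, x ∈ A.1} with hU
  have hUM : U ⊂ M := by
    refine Set.ssubset_iff_subset_ne.2 ⟨?_, fun he => hne (Set.eq_univ_of_forall fun C => ?_)⟩
    · rintro x ⟨A, -, hx⟩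
      exact subset_of_mem_maxPartition A.2 hx
    · obtain ⟨x, hx⟩ := (isStrongModule_of_mem C.2).nonempty
      have hxU := subset_of_mem_maxPartition C.2 hx
      rw [← he] at hxU
      obtain ⟨D, hD, hxD⟩ := hxU
      rwa [Subtype.ext (eq_of_mem_of_mem C.2 D.2 hx hxD)]
  obtain ⟨N, hUN, hN⟩ := Finite.exists_le_maximal (p := fun N : Set V => IsModule c N ∧ N ⊂ M)
    ⟨isModule_of_isModuleOn_quotient hM hM' hN₀, hUM⟩
  obtain ⟨x, hx⟩ := (isStrongModule_of_mem A.2).nonempty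
  obtain ⟨y, hy⟩ := (isStrongModule_of_mem B.2).nonempty
  have hxN : x ∈ N := hUN ⟨A, hA, hx⟩
  have hyN : y ∈ N := hUN ⟨B, hB, hy⟩
  -- A strong `N` would lie in a single child, but it meets the two parts `A` and `B`.
  have hns : ¬ IsStrongModule c N := by
    intro hs
    obtain ⟨D, hD, hxD⟩ := exists_isChild (c := c) hM' (hN.prop.2.1 hxN)
    have hyD := hD.subset_of_mem hs hN.prop.2 hxD hxN hyN
    exact hAB (Subtype.ext ((eq_of_mem_of_mem A.2 (Or.inl hD) hx hxD).trans
      (eq_of_mem_of_mem B.2 (Or.inl hD) hy hyD).symm))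
  obtain ⟨N', hN', h1, h2', h3⟩ : ∃ N', IsModule c N' ∧ ¬ N ⊆ N' ∧ ¬ N' ⊆ N ∧
      (N ∩ N').Nonempty := by
    by_contra hcon
    refine hns ⟨⟨x, hxN⟩, hN.prop.1, fun N' hN' => ?_⟩
    by_contra h
    rw [not_or, not_or] at h
    exact hcon ⟨N', hN', h.1, h.2.1, Set.nonempty_iff_ne_empty.2 h.2.2⟩
  have hN'M : N' ⊆ M := by
    rcases hM.strong N' hN' with h | h | h
    · exact absurd (hN.prop.2.1.trans h) h1
    · exact h
    · obtain ⟨z, hzN, hzN'⟩ := h3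
      exact absurd (show z ∈ M ∩ N' from ⟨hN.prop.2.1 hzN, hzN'⟩) (by simp [h])
  -- Overlapping modules have a module as union, so maximality of `N` leaves only `M`.
  have hunion : N ∪ N' = M := by
    by_contra hne'
    exact h2' (Set.subset_union_right.trans (hN.2 ⟨hN.prop.1.union hN' h3,
      (Set.union_subset hN.prop.2.1 hN'M).ssubset_of_ne hne'⟩ Set.subset_union_left))
  obtain ⟨a, haN, haN'⟩ := Set.not_subset.1 h1
  obtain ⟨b, hbN', hbN⟩ := Set.not_subset.1 h2'
  -- Since `M \ N'` lies in `N`, moving one end within `N'` to `b` and the other within `N` to `a`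
  -- shows that every edge across the cut has the color of `b a`.
  refine h2 ⟨color c b a, color c b a, fun A _ B _ hAB => Or.inl ?_⟩
  refine color_quotient_eq_of_cut hM _ (T := N') ⟨b, hN'M hbN', hbN'⟩
    ⟨a, hN.prop.2.1 haN, haN'⟩ ?_ hAB
  rintro y ⟨-, hy⟩ x ⟨hxM, hx⟩
  have hxN : x ∈ N := by
    rw [← hunion] at hxM
    exact hxM.resolve_right hx
  rw [hN'.color_eq hy hbN' hx, color_comm, hN.prop.1.color_eq hxN haN hbN, color_comm]

/-- At most two colors occur, at least one does, and exactly one would make `M` series.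
Nontriviality suffices, since a two-element strong module is always series. -/
theorem isEdgeColored_two_quotient [Finite V] {M : Set V} (hM : IsStrongPrimeModule c M)
    (hM' : M.Nontrivial) (hq : IsColoredPermGraph (quotient c M)) :
    IsEdgeColored (quotient c M) 2 := by
  have hpart := maxPartition_nontrivial (c := c) hM'
  obtain ⟨i, j, hij⟩ := atMostTwoOn_quotient hM.1 hM'
    (((isColoredPermGraph_iff _).1 hq).rainbowFree (color_comm _))
  have hs : (colors (quotient c M)).encard ≠ 1 := fun h => hM.2 ⟨hpart, h⟩
  obtain ⟨A, hA, B, hB, hAB⟩ := hpart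
  have hmem : ∀ k ∈ colors (quotient c M), some k = i ∨ some k = j := by
    rintro k ⟨A, B, h, rfl⟩
    rw [← color_of_ne _ h]
    exact hij A trivial B trivial h
  have hne : (colors (quotient c M)).Nonempty :=
    ⟨_, ⟨A, hA⟩, ⟨B, hB⟩, fun h => hAB (congrArg Subtype.val h), rfl⟩
  have h1 : 1 < (colors (quotient c M)).encard :=
    lt_of_le_of_ne (Set.one_le_encard_iff_nonempty.2 hne) hs.symm
  obtain ⟨k, l, hk, hl, hkl⟩ := Set.one_lt_encard_iff.1 h1
  have hset : colors (quotient c M) = {k, l} := by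
    refine Set.Subset.antisymm (fun m hm => ?_) (Set.insert_subset hk (Set.singleton_subset_iff.2 hl))
    have e1 := hmem k hk
    have e2 := hmem l hl
    have e3 := hmem m hm
    simp only [Set.mem_insert_iff, Set.mem_singleton_iff]
    grind
  rw [IsEdgeColored, hset]
  exact Set.encard_pair hkl

end StrongModules

end ColoredPerm

/-! ### The equivalences -/

open ColoredPerm SimpleGraph in
theorem mainTheorem1 {V K : Type*} [Finite V] [Nonempty V] (c : TopEdgeLabeling V K) :
    List.TFAE [
      IsColoredPermGraph c,
      ∀ W : Set V, W.Nonempty → IsColoredPermGraph (induced c W),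
      ∀ M : Set V, IsStrongModule c M → IsColoredPermGraph (quotient c M),
      (∀ M : Set V, IsStrongPrimeModule c M → IsColoredPermGraph (quotient c M)) ∧
        (∀ M : Set V, IsStrongPrimeModule c M → 3 ≤ M.encard → IsEdgeColored (quotient c M) 2),
      (∀ i ∈ colors c, IsPermGraph (c.labelGraph i)) ∧ ¬ HasRainbowTriangle c] ∧
    ((∀ M : Set V, IsStrongPrimeModule c M → IsColoredPermGraph (quotient c M)) →
      ∀ M : Set V, IsStrongPrimeModule c M → 3 ≤ M.encard → IsEdgeColored (quotient c M) 2) := by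
  have htwo : (∀ M : Set V, IsStrongPrimeModule c M → IsColoredPermGraph (quotient c M)) →
      ∀ M : Set V, IsStrongPrimeModule c M → 3 ≤ M.encard →
        IsEdgeColored (quotient c M) 2 := fun h M hM h3 =>
    isEdgeColored_two_quotient hM
      (Set.one_lt_encard_iff_nontrivial.1 (lt_of_lt_of_le (by norm_num) h3)) (h M hM)
  refine ⟨?_, htwo⟩
  tfae_have 1 → 2 := fun h W _ => h.pullback _
  tfae_have 2 → 1 := fun h => by
    refine (isColoredPermGraph_iff c).2 ?_
    refine (permOn_range_of_pullback _ (h Set.univ Set.univ_nonempty)).mono fun x _ => ?_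
    exact ⟨⟨x, trivial⟩, rfl⟩
  tfae_have 1 → 3 := fun h M _ => h.pullback _
  tfae_have 3 → 4 := fun h => ⟨fun M hM => h M hM.1, htwo fun M hM => h M hM.1⟩
  tfae_have 4 → 1 := fun h =>
    (isColoredPermGraph_iff c).2 (permOn_of_strongPrimeModules h.1 (isStrongModule_univ c))
  tfae_have 1 → 5 := by
    intro h
    refine ⟨fun i hi => ?_, (rainbowFree_iff c).1
      (((isColoredPermGraph_iff c).1 h).rainbowFree (color_comm c))⟩
    obtain ⟨l, π, h⟩ := h
    exact ⟨l, π ⟨i, hi⟩, h ⟨i, hi⟩⟩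
  tfae_have 5 → 1 := by
    rintro ⟨h, hr⟩
    refine (isColoredPermGraph_iff c).2 (permOn_of_rainbowFree (color_comm c)
      ((rainbowFree_iff c).2 hr) ?_ Set.univ)
    rintro i ⟨x, y, hxy, rfl⟩
    rw [color_of_ne c hxy]
    exact permOn_of_isPermGraph (h _ ⟨x, y, hxy, rfl⟩)
  tfae_finish
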